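/- Let $\mathsf{Atm}$ be a countable set of propositional variables and let formulas be given in negation normal form by $A ::= p \mid \bar p \mid A\wedge A \mid A\vee A \mid \Box A \mid \Diamond A$ ($p\in\mathsf{Atm}$), with $\bar A$ defined by de Morgan duality and $A\supset B := \bar A\vee B$. For $X\subseteq\{n\in\mathbb N : n>1\}$ let $\mathsf K+\mathsf 4^X$ be the Hilbert system consisting of classical propositional logic, the axiom schema $\Box(A\supset B)\supset(\Box A\supset\Box B)$, the axiom schemas $\Diamond^nA\supset\Diamond A$ for $n\in X$, modus ponens, and necessitation (from $A$ infer $\Box A$). A nested sequent is a finite multiset of formulas and of boxed sequents $[\Gamma]$, where $\Gamma$ is a nested sequent. A context $\Gamma\{\ \}$ is a nested sequent with one hole, which stands in the place of a formula (possibly inside boxed sequents, but not inside a formula), and $\Gamma\{\Delta\}$ is the result of putting $\Delta$ into the hole. The system $\mathsf{nK}$ has the axioms $\Gamma\{p,\bar p\}$ ($p \in \mathsf{Atm}$) and the rules $$\frac{\Gamma\{A,B\}}{\Gamma\{A\vee B\}}\qquad \frac{\Gamma\{A\}\quad\Gamma\{B\}}{\Gamma\{A\wedge B\}}\qquad \frac{\Gamma\{[A]\}}{\Gamma\{\Box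 A\}}\qquad \frac{\Gamma\{\Diamond A,[A,\Delta]\}}{\Gamma\{\Diamond A,[\Delta]\}}.$$ For $n>1$ the rule $\Diamond_{\mathsf 4n}$ is $$\frac{\Gamma\{\Diamond A,[\Delta_1,[\dots,[\Delta_{n-2},[\Diamond A,\Delta_{n-1}]]\dots]]\}}{\Gamma\{\Diamond A,[\Delta_1,[\dots,[\Delta_{n-2},[\Delta_{n-1}]]\dots]]\}},$$ and $\Diamond_{\mathsf 4X}:=\{\Diamond_{\mathsf 4n}: n\in X\}$. Theorem. Let $X\subseteq\{n\in\mathbb N: n>1\}$ and let $A$ be a formula. Then $\mathsf K+\mathsf 4^X\vdash A$ if and only if $\mathsf{nK}+\Diamond_{\mathsf 4X}\vdash A$, that is, the nested sequent consisting of the single formula $A$ has a (cut-free) proof in $\mathsf{nK}+\Diamond_{\mathsf 4X}$. -/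

import Mathlib

namespace QuasiTrans

/-- Modal formulas in negation normal form over a set `Atm` of propositional variables. -/
inductive Formula (Atm : Type*) where
  | atom (p : Atm) : Formula Atm
  | natom (p : Atm) : Formula Atm
  | and (A B : Formula Atm) : Formula Atm
  | or (A B : Formula Atm) : Formula Atm
  | box (A : Formula Atm) : Formula Atm
  | dia (A : Formula Atm) : Formula Atm

namespace Formula

variable {Atm : Type*}

/-- Negation, by de Morgan duality. -/
def neg : Formula Atm → Formula Atm
  | atom p => natom p
  | natom p => atom p
  | and A B => or (neg A) (neg B)
  | or A B => and (neg A) (neg B)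
  | box A => dia (neg A)
  | dia A => box (neg A)

/-- Implication `A ⊃ B`, defined as `Ā ∨ B`. -/
def imp (A B : Formula Atm) : Formula Atm := or (neg A) B

/-- `◇ⁿ A`. -/
def diaPow : ℕ → Formula Atm → Formula Atm
  | 0, A => A
  | n + 1, A => dia (diaPow n A)

/-- Truth of a formula under a Boolean assignment `v` of its propositional constituents: the
variables and the formulas `□ B` are assigned truth values freely, and `◇ B` is read as the
negation of `□ B̄`. -/
def boolEval (v : Formula Atm → Prop) : Formula Atm → Prop
  | atom p => v (atom p)
  | natom p => ¬ v (atom p)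
  | and A B => boolEval v A ∧ boolEval v B
  | or A B => boolEval v A ∨ boolEval v B
  | box A => v (box A)
  | dia A => ¬ v (box (neg A))

/-- `A` is (a substitution instance of) a classical propositional tautology. -/
def Tautology (A : Formula Atm) : Prop := ∀ v : Formula Atm → Prop, boolEval v A

end Formula

/-- Theoremhood in the Hilbert system `K + Ax`: classical propositional logic, the schema
`k : □(A ⊃ B) ⊃ (□A ⊃ □B)`, the additional axioms `Ax`, modus ponens and necessitation. -/
inductive KTheorem {Atm : Type*} (Ax : Set (Formula Atm)) : Formula Atm → Prop
  | taut {A : Formula Atm} : A.Tautology → KTheorem Ax A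
  | k (A B : Formula Atm) : KTheorem Ax ((A.imp B).box.imp (A.box.imp B.box))
  | ax {A : Formula Atm} : A ∈ Ax → KTheorem Ax A
  | mp {A B : Formula Atm} : KTheorem Ax (A.imp B) → KTheorem Ax A → KTheorem Ax B
  | nec {A : Formula Atm} : KTheorem Ax A → KTheorem Ax A.box

/-- The quasi-transitivity axioms `4ⁿ : ◇ⁿ A ⊃ ◇ A` for `n ∈ X` (all instances of the schemas). -/
def quasiTransAxioms (Atm : Type*) (X : Set ℕ) : Set (Formula Atm) :=
  {F | ∃ n ∈ X, ∃ A : Formula Atm, F = (A.diaPow n).imp A.dia}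

/-- Ordered representatives of nested sequents: `Γ ::= ∅ | A, Γ | [Δ], Γ`. -/
inductive PreSequent (Atm : Type*) where
  | nil : PreSequent Atm
  | consFormula (A : Formula Atm) (Γ : PreSequent Atm) : PreSequent Atm
  | consBox (Δ Γ : PreSequent Atm) : PreSequent Atm

namespace PreSequent

variable {Atm : Type*}

/-- Equality up to the order of the elements, at every level of nesting. -/
inductive Equiv : PreSequent Atm → PreSequent Atm → Prop
  | refl (Γ : PreSequent Atm) : Equiv Γ Γ
  | symm {Γ Γ' : PreSequent Atm} : Equiv Γ Γ' → Equiv Γ' Γ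
  | trans {Γ Γ' Γ'' : PreSequent Atm} : Equiv Γ Γ' → Equiv Γ' Γ'' → Equiv Γ Γ''
  | consFormula (A : Formula Atm) {Γ Γ' : PreSequent Atm} :
      Equiv Γ Γ' → Equiv (.consFormula A Γ) (.consFormula A Γ')
  | consBox {Δ Δ' Γ Γ' : PreSequent Atm} :
      Equiv Δ Δ' → Equiv Γ Γ' → Equiv (.consBox Δ Γ) (.consBox Δ' Γ')
  | swapFormulas (A B : Formula Atm) (Γ : PreSequent Atm) :
      Equiv (.consFormula A (.consFormula B Γ)) (.consFormula B (.consFormula A Γ))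
  | swapFormulaBox (A : Formula Atm) (Δ Γ : PreSequent Atm) :
      Equiv (.consFormula A (.consBox Δ Γ)) (.consBox Δ (.consFormula A Γ))
  | swapBoxes (Δ Δ' Γ : PreSequent Atm) :
      Equiv (.consBox Δ (.consBox Δ' Γ)) (.consBox Δ' (.consBox Δ Γ))

instance setoid (Atm : Type*) : Setoid (PreSequent Atm) where
  r := Equiv
  iseqv := ⟨Equiv.refl, Equiv.symm, Equiv.trans⟩

/-- Concatenation. -/
def append : PreSequent Atm → PreSequent Atm → PreSequent Atm
  | nil, Θ => Θ
  | consFormula A Γ, Θ => consFormula A (append Γ Θ)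
  | consBox Δ Γ, Θ => consBox Δ (append Γ Θ)

theorem append_equiv_right (Γ : PreSequent Atm) {Θ Θ' : PreSequent Atm} (h : Equiv Θ Θ') :
    Equiv (append Γ Θ) (append Γ Θ') := by
  induction Γ with
  | nil => exact h
  | consFormula A Γ ih => exact .consFormula A ih
  | consBox Δ Γ _ ih => exact .consBox (.refl Δ) ih

theorem append_equiv_left {Γ Γ' : PreSequent Atm} (h : Equiv Γ Γ') (Θ : PreSequent Atm) :
    Equiv (append Γ Θ) (append Γ' Θ) := by
  induction h with
  | refl Γ => exact .refl _
  | symm _ ih => exact .symm ih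
  | trans _ _ ih₁ ih₂ => exact .trans ih₁ ih₂
  | consFormula A _ ih => exact .consFormula A ih
  | consBox h _ _ ih => exact .consBox h ih
  | swapFormulas A B Γ => exact .swapFormulas A B _
  | swapFormulaBox A Δ Γ => exact .swapFormulaBox A Δ _
  | swapBoxes Δ Δ' Γ => exact .swapBoxes Δ Δ' _

end PreSequent

/-- Nested sequents: finite multisets of formulas and boxed nested sequents. -/
def NSequent (Atm : Type*) : Type _ := Quotient (PreSequent.setoid Atm)

namespace NSequent

variable {Atm : Type*}

/-- The empty sequent. -/
def empty : NSequent Atm := Quotient.mk _ .nil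

instance : Zero (NSequent Atm) := ⟨empty⟩

/-- Multiset union, written `Γ, Δ` on paper and `Γ + Δ` here. -/
def union : NSequent Atm → NSequent Atm → NSequent Atm :=
  Quotient.map₂ PreSequent.append fun _ Γ' h _ _ h' =>
    (PreSequent.append_equiv_left h _).trans (PreSequent.append_equiv_right Γ' h')

instance : Add (NSequent Atm) := ⟨union⟩

/-- The sequent whose only element is the formula `A`. -/
def ofFormula (A : Formula Atm) : NSequent Atm := Quotient.mk _ (.consFormula A .nil)

/-- The sequent `[Δ]`, whose only element is the boxed sequent `[Δ]`. -/
def boxed : NSequent Atm → NSequent Atm :=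
  Quotient.map (fun Δ => .consBox Δ .nil) fun _ _ h => .consBox h (.refl _)

/-- `[Δ₁, [Δ₂, [… [Δₘ, Θ] …]]]` for the list `Δ₁, …, Δₘ`. -/
def chain : List (NSequent Atm) → NSequent Atm → NSequent Atm
  | [], Θ => Θ
  | Δ :: Δs, Θ => boxed (Δ + chain Δs Θ)

end NSequent

/-- Contexts with one hole: either `Γ, { }` or `Γ, [C{ }]`. -/
inductive Context (Atm : Type*) where
  | hole (Γ : NSequent Atm) : Context Atm
  | nest (Γ : NSequent Atm) (C : Context Atm) : Context Atm

/-- Replacing the hole of a context by a sequent. -/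
def Context.fill {Atm : Type*} : Context Atm → NSequent Atm → NSequent Atm
  | .hole Γ, Θ => Γ + Θ
  | .nest Γ C, Θ => Γ + NSequent.boxed (C.fill Θ)

/-- A nested sequent system, given by its rule instances (list of premises, conclusion). -/
abbrev System (Atm : Type*) := Set (List (NSequent Atm) × NSequent Atm)

/-- Provability: there is a finite tree built from instances of the rules of the system. -/
inductive Provable {Atm : Type*} (S : System Atm) : NSequent Atm → Prop
  | infer {Ps : List (NSequent Atm)} {Γ : NSequent Atm} :
      (Ps, Γ) ∈ S → (∀ P ∈ Ps, Provable S P) → Provable S Γ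

open NSequent in
/-- The rule instances of the system `nK`. -/
inductive NKRule {Atm : Type*} : List (NSequent Atm) → NSequent Atm → Prop
  | id (C : Context Atm) (p : Atm) :
      NKRule [] (C.fill (ofFormula (.atom p) + ofFormula (.natom p)))
  | or (C : Context Atm) (A B : Formula Atm) :
      NKRule [C.fill (ofFormula A + ofFormula B)] (C.fill (ofFormula (.or A B)))
  | and (C : Context Atm) (A B : Formula Atm) :
      NKRule [C.fill (ofFormula A), C.fill (ofFormula B)] (C.fill (ofFormula (.and A B)))
  | box (C : Context Atm) (A : Formula Atm) :
      NKRule [C.fill (boxed (ofFormula A))] (C.fill (ofFormula (.box A)))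
  | dia (C : Context Atm) (A : Formula Atm) (Δ : NSequent Atm) :
      NKRule [C.fill (ofFormula (.dia A) + boxed (ofFormula A + Δ))]
        (C.fill (ofFormula (.dia A) + boxed Δ))

/-- The system `nK`. -/
def nK (Atm : Type*) : System Atm := {r | NKRule r.1 r.2}

open NSequent in
/-- The instances of the rule `◇₄ₙ` (for `n > 1`), with premise
`C{◇A, [Δ₁, [… [Δₙ₋₂, [◇A, Δₙ₋₁]] …]]}` and conclusion `C{◇A, [Δ₁, [… [Δₙ₋₂, [Δₙ₋₁]] …]]}`. -/
def dia4 (Atm : Type*) (n : ℕ) : System Atm :=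
  {r | ∃ (C : Context Atm) (A : Formula Atm) (Δs : List (NSequent Atm)), Δs.length + 1 = n ∧
    r = ([C.fill (ofFormula (.dia A) + chain Δs (ofFormula (.dia A)))],
      C.fill (ofFormula (.dia A) + chain Δs 0))}

/-- The rules `◇₄ₙ` for `n ∈ X`. -/
def dia4Set (Atm : Type*) (X : Set ℕ) : System Atm := ⋃ n ∈ X, dia4 Atm n

end QuasiTrans

/-!
Soundness is algebraic. A sequent denotes an element of a modal algebra, commas being joins and
brackets being boxes, and a context denotes an operation that preserves finite meets. In an algebra
with `◇ⁿ a ≤ ◇ a` for `n ∈ X` every rule therefore preserves the value `⊤`; applied to the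
Lindenbaum algebra of `K + 4^X`, this turns nested proofs into Hilbert proofs.

For completeness, an unprovable sequent can be extended, reading the rules upwards, to an unprovable
sequent that meets any single demand of the rules. Only countably many demands concern the
subformulas of a given formula, so a generic ideal of unprovable sequents meets all of them
(Rasiowa–Sikorski); its limit is a labelling of the tree of positions that is saturated under the
rules. Call `w ++ v` accessible from `w` if the length of `v` is `s + 1` with `s` in the submonoid
of `ℕ` generated by the `n - 1`, `n ∈ X`. This frame validates `4^X`, and saturation under the
propagation rules carries `◇A` along all of the `s` levels, so that every formula in the label of a
point is false there.
-/

namespace QuasiTrans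

variable {Atm : Type*}

section Sequents

namespace PreSequent

theorem append_nil (Γ : PreSequent Atm) : append Γ nil = Γ := by
  induction Γ <;> simp_all [append]

theorem append_assoc (Γ Δ Θ : PreSequent Atm) :
    append (append Γ Δ) Θ = append Γ (append Δ Θ) := by
  induction Γ <;> simp_all [append]

theorem append_consFormula_equiv (Γ Δ : PreSequent Atm) (A : Formula Atm) :
    Equiv (append Γ (consFormula A Δ)) (consFormula A (append Γ Δ)) := by
  induction Γ with
  | nil => exact .refl _
  | consFormula B Γ ih => exact (Equiv.consFormula B ih).trans (.swapFormulas _ _ _)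
  | consBox Θ Γ _ ih => exact (Equiv.consBox (.refl Θ) ih).trans (.symm (.swapFormulaBox _ _ _))

theorem append_consBox_equiv (Γ Δ Θ : PreSequent Atm) :
    Equiv (append Γ (consBox Θ Δ)) (consBox Θ (append Γ Δ)) := by
  induction Γ with
  | nil => exact .refl _
  | consFormula B Γ ih => exact (Equiv.consFormula B ih).trans (.swapFormulaBox _ _ _)
  | consBox Λ Γ _ ih => exact (Equiv.consBox (.refl Λ) ih).trans (.swapBoxes _ _ _)

theorem append_comm_equiv (Γ Δ : PreSequent Atm) : Equiv (append Γ Δ) (append Δ Γ) := by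
  induction Γ with
  | nil => rw [append_nil]; exact .refl _
  | consFormula B Γ ih =>
    exact (Equiv.consFormula B ih).trans (.symm (append_consFormula_equiv _ _ _))
  | consBox Λ Γ _ ih =>
    exact (Equiv.consBox (.refl Λ) ih).trans (.symm (append_consBox_equiv _ _ _))

end PreSequent

instance : AddCommMonoid (NSequent Atm) where
  add_assoc := by
    rintro ⟨Γ⟩ ⟨Δ⟩ ⟨Θ⟩
    exact congrArg (Quotient.mk _) (PreSequent.append_assoc Γ Δ Θ)
  zero_add := by
    rintro ⟨Γ⟩
    rfl
  add_zero := by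
    rintro ⟨Γ⟩
    exact congrArg (Quotient.mk _) (PreSequent.append_nil Γ)
  add_comm := by
    rintro ⟨Γ⟩ ⟨Δ⟩
    exact Quotient.sound (PreSequent.append_comm_equiv Γ Δ)
  nsmul := nsmulRec

end Sequents

section ModalAlgebra

variable {α : Type*} [BooleanAlgebra α] (ν : InfTopHom α α) (V : Atm → α) {X : Set ℕ}

/-- The diamond `a ↦ (□ aᶜ)ᶜ` of the modal algebra given by a Boolean algebra and an operator `□`
that preserves finite meets. -/
def diamond (a : α) : α := (ν aᶜ)ᶜ

theorem map_sup_le_diamond_sup (a b : α) : ν (a ⊔ b) ≤ diamond ν a ⊔ ν b := by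
  rw [diamond, sup_comm (ν aᶜ)ᶜ, ← himp_eq, le_himp_iff, ← map_inf]
  exact OrderHomClass.mono ν (by simp [inf_sup_right])

/-- A modal algebra is `X`-quasi-transitive if it satisfies `◇ⁿ a ≤ ◇ a` for all `n ∈ X`; this is
the algebraic form of the axioms `quasiTransAxioms`. -/
def IsQuasiTransitive (X : Set ℕ) : Prop :=
  ∀ n ∈ X, ∀ a : α, (diamond ν)^[n] a ≤ diamond ν a

/-- The value of a formula in a modal algebra under the valuation `V` of its variables. -/
def Formula.eval : Formula Atm → α
  | atom p => V p
  | natom p => (V p)ᶜ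
  | and A B => A.eval ⊓ B.eval
  | or A B => A.eval ⊔ B.eval
  | box A => ν A.eval
  | dia A => diamond ν A.eval

/-- The value of an ordered nested sequent: commas are joins and brackets are boxes. -/
def PreSequent.eval : PreSequent Atm → α
  | nil => ⊥
  | consFormula A Γ => A.eval ν V ⊔ Γ.eval
  | consBox Δ Γ => ν Δ.eval ⊔ Γ.eval

theorem Formula.eval_neg (A : Formula Atm) : A.neg.eval ν V = (A.eval ν V)ᶜ := by
  induction A <;> simp_all [neg, eval, diamond]

theorem Formula.eval_imp (A B : Formula Atm) :
    (A.imp B).eval ν V = A.eval ν V ⇨ B.eval ν V := by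
  rw [imp, eval, eval_neg, himp_eq, sup_comm]

theorem Formula.eval_diaPow (n : ℕ) (A : Formula Atm) :
    (A.diaPow n).eval ν V = (diamond ν)^[n] (A.eval ν V) := by
  induction n with
  | zero => rfl
  | succ n ih => rw [diaPow, eval, ih, Function.iterate_succ_apply']

theorem PreSequent.Equiv.eval_eq {Γ Δ : PreSequent Atm} (h : Equiv Γ Δ) :
    Γ.eval ν V = Δ.eval ν V := by
  induction h with
  | refl Γ => rfl
  | symm _ ih => exact ih.symm
  | trans _ _ ih₁ ih₂ => exact ih₁.trans ih₂
  | consFormula A _ ih => rw [eval, eval, ih]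
  | consBox _ _ ih₁ ih₂ => rw [eval, eval, ih₁, ih₂]
  | swapFormulas A B Γ => exact sup_left_comm _ _ _
  | swapFormulaBox A Δ Γ => exact sup_left_comm _ _ _
  | swapBoxes Δ Δ' Γ => exact sup_left_comm _ _ _

theorem PreSequent.eval_append (Γ Δ : PreSequent Atm) :
    (Γ.append Δ).eval ν V = Γ.eval ν V ⊔ Δ.eval ν V := by
  induction Γ with
  | nil => exact (bot_sup_eq _).symm
  | consFormula A Γ ih => rw [append, eval, eval, ih, sup_assoc]
  | consBox Θ Γ _ ih => rw [append, eval, eval, ih, sup_assoc]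

namespace NSequent

/-- The value of a nested sequent in a modal algebra. -/
def eval : NSequent Atm → α :=
  Quotient.lift (PreSequent.eval ν V) fun _ _ h => h.eval_eq ν V

theorem eval_add (Γ Δ : NSequent Atm) :
    (Γ + Δ).eval ν V = Γ.eval ν V ⊔ Δ.eval ν V := by
  induction Γ, Δ using Quotient.inductionOn₂ with
  | h Γ Δ => exact Γ.eval_append ν V Δ

theorem eval_ofFormula (A : Formula Atm) : (ofFormula A).eval ν V = A.eval ν V :=
  sup_bot_eq _

theorem eval_boxed (Δ : NSequent Atm) : Δ.boxed.eval ν V = ν (Δ.eval ν V) := by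
  induction Δ using Quotient.inductionOn with
  | h Δ => exact sup_bot_eq _

theorem eval_chain_dia_le (Δs : List (NSequent Atm)) (A : Formula Atm) :
    (chain Δs (ofFormula A.dia)).eval ν V ≤
      (diamond ν)^[Δs.length + 1] (A.eval ν V) ⊔ (chain Δs 0).eval ν V := by
  induction Δs with
  | nil =>
    rw [chain, eval_ofFormula]
    exact le_sup_left
  | cons Δ Δs ih =>
    simp only [chain, eval_boxed, eval_add, List.length_cons,
      Function.iterate_succ_apply' _ (Δs.length + 1)]
    refine le_trans (OrderHomClass.mono ν ?_) (map_sup_le_diamond_sup ν _ _)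
    rw [sup_left_comm]
    exact sup_le_sup_left ih _

end NSequent

/-- The join with a fixed element, as a homomorphism of meet-semilattices with top. -/
def supHom (c : α) : InfTopHom α α where
  toFun a := c ⊔ a
  map_inf' := sup_inf_left c
  map_top' := sup_top_eq c

/-- The operation on a modal algebra given by a context. It preserves finite meets, so a rule that
is sound in the empty context is sound in every context. -/
def Context.eval : Context Atm → InfTopHom α α
  | hole Γ => supHom (Γ.eval ν V)
  | nest Γ C => (supHom (Γ.eval ν V)).comp (ν.comp C.eval)

theorem Context.eval_fill (C : Context Atm) (Θ : NSequent Atm) :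
    (C.fill Θ).eval ν V = C.eval ν V (Θ.eval ν V) := by
  induction C with
  | hole Γ => exact NSequent.eval_add ν V Γ Θ
  | nest Γ C ih => rw [fill, NSequent.eval_add, NSequent.eval_boxed, ih]; rfl

theorem Context.eval_fill_eq_top_of_le (C : Context Atm) {Θ Λ : NSequent Atm}
    (hle : Θ.eval ν V ≤ Λ.eval ν V) (h : (C.fill Θ).eval ν V = ⊤) :
    (C.fill Λ).eval ν V = ⊤ := by
  rw [eval_fill] at h ⊢
  exact top_unique (h.ge.trans (OrderHomClass.mono _ hle))

open NSequent

theorem NKRule.eval_eq_top {Ps : List (NSequent Atm)} {Γ : NSequent Atm} (h : NKRule Ps Γ)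
    (hP : ∀ P ∈ Ps, P.eval ν V = ⊤) : Γ.eval ν V = ⊤ := by
  cases h with
  | id C p =>
    rw [C.eval_fill, eval_add, eval_ofFormula, eval_ofFormula, Formula.eval, Formula.eval,
      sup_compl_eq_top, map_top]
  | or C A B =>
    refine C.eval_fill_eq_top_of_le ν V ?_ (hP _ (List.mem_singleton_self _))
    simp only [eval_add, eval_ofFormula, Formula.eval, le_refl]
  | and C A B =>
    have hA := hP (C.fill (ofFormula A)) (by simp)
    have hB := hP (C.fill (ofFormula B)) (by simp)
    rw [C.eval_fill, eval_ofFormula] at *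
    rw [Formula.eval, map_inf, hA, hB, inf_top_eq]
  | box C A =>
    refine C.eval_fill_eq_top_of_le ν V ?_ (hP _ (List.mem_singleton_self _))
    simp only [eval_boxed, eval_ofFormula, Formula.eval, le_refl]
  | dia C A Δ =>
    refine C.eval_fill_eq_top_of_le ν V ?_ (hP _ (List.mem_singleton_self _))
    simp only [eval_add, eval_boxed, eval_ofFormula]
    exact sup_le le_sup_left (map_sup_le_diamond_sup ν _ _)

variable {ν}

theorem IsQuasiTransitive.eval_eq_top_of_mem_dia4 (hν : IsQuasiTransitive ν X) {n : ℕ}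
    (hn : n ∈ X) {Ps : List (NSequent Atm)} {Γ : NSequent Atm} (h : (Ps, Γ) ∈ dia4 Atm n)
    (hP : ∀ P ∈ Ps, P.eval ν V = ⊤) : Γ.eval ν V = ⊤ := by
  obtain ⟨C, A, Δs, rfl, h⟩ := h
  obtain ⟨rfl, rfl⟩ := Prod.mk.inj h
  refine C.eval_fill_eq_top_of_le ν V ?_ (hP _ (List.mem_singleton_self _))
  rw [eval_add, eval_add, eval_ofFormula]
  exact sup_le le_sup_left <|
    (eval_chain_dia_le ν V Δs A).trans (sup_le_sup_right (hν _ hn _) _)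

theorem IsQuasiTransitive.eval_eq_top_of_provable (hν : IsQuasiTransitive ν X)
    {Γ : NSequent Atm} (h : Provable (nK Atm ∪ dia4Set Atm X) Γ) : Γ.eval ν V = ⊤ := by
  induction h with
  | infer hr _ ih =>
    rcases hr with hr | hr
    · exact NKRule.eval_eq_top ν V hr ih
    · simp only [dia4Set, Set.mem_iUnion] at hr
      obtain ⟨n, hn, hr⟩ := hr
      exact hν.eval_eq_top_of_mem_dia4 V hn hr ih

end ModalAlgebra

section Lindenbaum

open Formula

variable {Ax : Set (Formula Atm)}

theorem Formula.neg_neg (A : Formula Atm) : A.neg.neg = A := by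
  induction A <;> simp_all [neg]

theorem Formula.boolEval_neg (v : Formula Atm → Prop) (A : Formula Atm) :
    boolEval v A.neg ↔ ¬ boolEval v A := by
  induction A with
  | and A B hA hB => rw [neg, boolEval, boolEval, hA, hB, not_and_or]
  | or A B hA hB => rw [neg, boolEval, boolEval, hA, hB, not_or]
  | box A => rw [neg, boolEval, boolEval, neg_neg]
  | _ => simp [neg, boolEval]

theorem Formula.boolEval_imp (v : Formula Atm → Prop) (A B : Formula Atm) :
    boolEval v (A.imp B) ↔ (boolEval v A → boolEval v B) := by
  rw [imp, boolEval, boolEval_neg, imp_iff_not_or]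

theorem KTheorem.of_boolEval {A B C : Formula Atm} (hA : KTheorem Ax A) (hB : KTheorem Ax B)
    (h : ∀ v, boolEval v A → boolEval v B → boolEval v C) : KTheorem Ax C :=
  .mp (.mp (.taut fun v => by simpa only [boolEval_imp] using h v) hA) hB

theorem KTheorem.box_mono {A B : Formula Atm} (h : KTheorem Ax (A.imp B)) :
    KTheorem Ax (A.box.imp B.box) :=
  .mp (.k A B) h.nec

theorem KTheorem.box_and (A B : Formula Atm) :
    KTheorem Ax ((A.box.and B.box).imp (A.and B).box) := by
  have hA : KTheorem Ax (A.imp (B.imp (A.and B))) := .taut fun v => by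
    simp only [boolEval_imp, boolEval]; tauto
  refine hA.box_mono.of_boolEval (.k B (A.and B)) fun v => ?_
  simp only [boolEval_imp, boolEval]; tauto

theorem KTheorem.imp_trans {A B C : Formula Atm} (hAB : KTheorem Ax (A.imp B))
    (hBC : KTheorem Ax (B.imp C)) : KTheorem Ax (A.imp C) :=
  hAB.of_boolEval hBC fun v => by simp only [boolEval_imp]; tauto

theorem KTheorem.or_imp_or {A A' B B' : Formula Atm} (hA : KTheorem Ax (A.imp A'))
    (hB : KTheorem Ax (B.imp B')) : KTheorem Ax ((A.or B).imp (A'.or B')) :=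
  hA.of_boolEval hB fun v => by simp only [boolEval_imp, boolEval]; tauto

theorem KTheorem.and_imp_and {A A' B B' : Formula Atm} (hA : KTheorem Ax (A.imp A'))
    (hB : KTheorem Ax (B.imp B')) : KTheorem Ax ((A.and B).imp (A'.and B')) :=
  hA.of_boolEval hB fun v => by simp only [boolEval_imp, boolEval]; tauto

theorem KTheorem.neg_imp_neg {A B : Formula Atm} (h : KTheorem Ax (A.imp B)) :
    KTheorem Ax (B.neg.imp A.neg) :=
  h.of_boolEval h fun v => by simp only [boolEval_imp, boolEval_neg]; tauto

/-- The preorder of provable implication in `K + Ax`. -/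
abbrev entailment (Ax : Set (Formula Atm)) : Preorder (Formula Atm) where
  le A B := KTheorem Ax (A.imp B)
  le_refl A := .taut fun v => (boolEval_imp v A A).2 id
  le_trans _ _ _ := KTheorem.imp_trans

/-- The Lindenbaum algebra of `K + Ax`: formulas up to provable equivalence. -/
def Lindenbaum (Ax : Set (Formula Atm)) : Type _ :=
  @Antisymmetrization (Formula Atm) (entailment Ax).le inferInstance

namespace Lindenbaum

instance : PartialOrder (Lindenbaum Ax) :=
  @instPartialOrderAntisymmetrization (Formula Atm) (entailment Ax)

/-- The class of a formula in the Lindenbaum algebra. -/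
def mk (Ax : Set (Formula Atm)) (A : Formula Atm) : Lindenbaum Ax :=
  @toAntisymmetrization (Formula Atm) (entailment Ax).le inferInstance A

theorem mk_le_mk {A B : Formula Atm} : mk Ax A ≤ mk Ax B ↔ KTheorem Ax (A.imp B) := Iff.rfl

variable [Nonempty Atm]

noncomputable instance : BooleanAlgebra (Lindenbaum Ax) where
  sup := Quotient.map₂ Formula.or fun _ _ hA _ _ hB =>
    ⟨KTheorem.or_imp_or hA.1 hB.1, KTheorem.or_imp_or hA.2 hB.2⟩
  inf := Quotient.map₂ Formula.and fun _ _ hA _ _ hB =>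
    ⟨KTheorem.and_imp_and hA.1 hB.1, KTheorem.and_imp_and hA.2 hB.2⟩
  compl := Quotient.map Formula.neg fun _ _ h =>
    ⟨KTheorem.neg_imp_neg h.2, KTheorem.neg_imp_neg h.1⟩
  top := mk Ax (.or (.atom (Classical.arbitrary Atm)) (.natom (Classical.arbitrary Atm)))
  bot := mk Ax (.and (.atom (Classical.arbitrary Atm)) (.natom (Classical.arbitrary Atm)))
  le_sup_left := by
    rintro ⟨A⟩ ⟨B⟩; exact .taut fun v => by simp only [boolEval_imp, boolEval]; tauto
  le_sup_right := by
    rintro ⟨A⟩ ⟨B⟩; exact .taut fun v => by simp only [boolEval_imp, boolEval]; tauto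
  sup_le := by
    rintro ⟨A⟩ ⟨B⟩ ⟨C⟩ hAC hBC
    exact (KTheorem.or_imp_or hAC hBC).imp_trans <| .taut fun v => by
      simp only [boolEval_imp, boolEval]; tauto
  inf_le_left := by
    rintro ⟨A⟩ ⟨B⟩; exact .taut fun v => by simp only [boolEval_imp, boolEval]; tauto
  inf_le_right := by
    rintro ⟨A⟩ ⟨B⟩; exact .taut fun v => by simp only [boolEval_imp, boolEval]; tauto
  le_inf := by
    rintro ⟨A⟩ ⟨B⟩ ⟨C⟩ hAB hAC
    refine KTheorem.imp_trans (B := A.and A) ?_ (KTheorem.and_imp_and hAB hAC)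
    exact .taut fun v => by simp only [boolEval_imp, boolEval]; tauto
  le_sup_inf := by
    rintro ⟨A⟩ ⟨B⟩ ⟨C⟩; exact .taut fun v => by simp only [boolEval_imp, boolEval]; tauto
  inf_compl_le_bot := by
    rintro ⟨A⟩; exact .taut fun v => by simp only [boolEval_imp, boolEval, boolEval_neg]; tauto
  top_le_sup_compl := by
    rintro ⟨A⟩; exact .taut fun v => by simp only [boolEval_imp, boolEval, boolEval_neg]; tauto
  le_top := by
    rintro ⟨A⟩; exact .taut fun v => by simp only [boolEval_imp, boolEval]; tauto
  bot_le := by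
    rintro ⟨A⟩; exact .taut fun v => by simp only [boolEval_imp, boolEval]; tauto

theorem mk_eq_top_iff {A : Formula Atm} : mk Ax A = ⊤ ↔ KTheorem Ax A := by
  refine ⟨fun h => .mp (mk_le_mk.1 h.ge) (.taut fun v => by simp only [boolEval]; tauto),
    fun h => top_unique (mk_le_mk.2 ?_)⟩
  exact h.of_boolEval h fun v => by simp only [boolEval_imp]; tauto

variable (Ax) in
/-- The operator of the Lindenbaum algebra induced by `A ↦ □A`. -/
noncomputable def box : InfTopHom (Lindenbaum Ax) (Lindenbaum Ax) where
  toFun := Quotient.map Formula.box fun _ _ h => ⟨KTheorem.box_mono h.1, KTheorem.box_mono h.2⟩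
  map_inf' := by
    rintro ⟨A⟩ ⟨B⟩
    refine le_antisymm (le_inf ?_ ?_) (KTheorem.box_and A B)
    · exact KTheorem.box_mono (.taut fun v => by simp only [boolEval_imp, boolEval]; tauto)
    · exact KTheorem.box_mono (.taut fun v => by simp only [boolEval_imp, boolEval]; tauto)
  map_top' := mk_eq_top_iff.2 (mk_eq_top_iff.1 rfl).nec

theorem eval_eq_mk (A : Formula Atm) : A.eval (box Ax) (fun p => mk Ax (.atom p)) = mk Ax A := by
  induction A with
  | atom p => rfl
  | natom p => rfl
  | and A B hA hB => rw [eval, hA, hB]; rfl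
  | or A B hA hB => rw [eval, hA, hB]; rfl
  | box A hA => rw [eval, hA]; rfl
  | dia A hA =>
    rw [eval, hA]
    exact congrArg (fun B => mk Ax B.dia) A.neg_neg

theorem isQuasiTransitive (X : Set ℕ) : IsQuasiTransitive (box (quasiTransAxioms Atm X)) X := by
  rintro n hn ⟨A⟩
  change (diamond _)^[n] (mk _ A) ≤ diamond _ (mk _ A)
  rw [← eval_eq_mk, ← Formula.eval_diaPow, ← Formula.eval, eval_eq_mk, eval_eq_mk, mk_le_mk]
  exact .ax ⟨n, hn, A, rfl⟩

end Lindenbaum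

theorem Formula.nonempty_atm (A : Formula Atm) : Nonempty Atm := by
  induction A <;> first | assumption | exact ⟨‹Atm›⟩

theorem Provable.kTheorem {X : Set ℕ} {A : Formula Atm}
    (h : Provable (nK Atm ∪ dia4Set Atm X) (.ofFormula A)) :
    KTheorem (quasiTransAxioms Atm X) A := by
  have := A.nonempty_atm
  rw [← Lindenbaum.mk_eq_top_iff, ← Lindenbaum.eval_eq_mk, ← NSequent.eval_ofFormula]
  exact (Lindenbaum.isQuasiTransitive X).eval_eq_top_of_provable _ h

end Lindenbaum

section Kripke

variable {W : Type*} (R : W → W → Prop) (V : Atm → Set W) {X : Set ℕ}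

/-- The complex algebra of a Kripke frame: the operator `□` on the set of worlds given by the
accessibility relation `R`. -/
def kripkeBox : InfTopHom (Set W) (Set W) where
  toFun S := {w | ∀ u, R w u → u ∈ S}
  map_inf' S T := by ext w; simp [imp_and, forall_and]
  map_top' := by ext w; simp

theorem mem_kripkeBox {S : Set W} {w : W} : w ∈ kripkeBox R S ↔ ∀ u, R w u → u ∈ S := Iff.rfl

theorem mem_diamond_kripkeBox {S : Set W} {w : W} :
    w ∈ diamond (kripkeBox R) S ↔ ∃ u, R w u ∧ u ∈ S := by
  simp [diamond, mem_kripkeBox]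

theorem boolEval_mem_eval_iff (w : W) (A : Formula Atm) :
    A.boolEval (fun B => w ∈ B.eval (kripkeBox R) V) ↔ w ∈ A.eval (kripkeBox R) V := by
  induction A with
  | dia A _ => simp [Formula.boolEval, Formula.eval, Formula.eval_neg, diamond]
  | _ => simp_all [Formula.boolEval, Formula.eval]

theorem KTheorem.eval_eq_top (hR : IsQuasiTransitive (kripkeBox R) X) {A : Formula Atm}
    (h : KTheorem (quasiTransAxioms Atm X) A) : A.eval (kripkeBox R) V = ⊤ := by
  induction h with
  | taut h => exact Set.eq_univ_of_forall fun w => (boolEval_mem_eval_iff R V w _).1 (h _)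
  | k A B =>
    simp only [Formula.eval_imp, Formula.eval, himp_eq_top_iff, le_himp_iff, ← map_inf]
    exact OrderHomClass.mono _ himp_inf_le
  | ax h =>
    obtain ⟨n, hn, A, rfl⟩ := h
    rw [Formula.eval_imp, himp_eq_top_iff, Formula.eval_diaPow]
    exact hR n hn _
  | mp _ _ ih₁ ih₂ => rwa [Formula.eval_imp, ih₂, top_himp] at ih₁
  | nec _ ih => rw [Formula.eval, ih, map_top]

end Kripke

section Positions

namespace PreSequent

/-- The nested sequent represented by an ordered one. -/
def toNSequent (Γ : PreSequent Atm) : NSequent Atm := Quotient.mk _ Γ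

theorem toNSequent_consFormula (A : Formula Atm) (Γ : PreSequent Atm) :
    (consFormula A Γ).toNSequent = .ofFormula A + Γ.toNSequent := rfl

theorem toNSequent_consBox (Δ Γ : PreSequent Atm) :
    (consBox Δ Γ).toNSequent = .boxed Δ.toNSequent + Γ.toNSequent := rfl

theorem toNSequent_append (Γ Δ : PreSequent Atm) :
    (Γ.append Δ).toNSequent = Γ.toNSequent + Δ.toNSequent := rfl

/-- The formulas at the root of an ordered nested sequent. -/
def formulas : PreSequent Atm → Set (Formula Atm)
  | nil => ∅
  | consFormula A Γ => insert A Γ.formulas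
  | consBox _ Γ => Γ.formulas

/-- The number of boxed sequents at the root of an ordered nested sequent. -/
def width : PreSequent Atm → ℕ
  | nil => 0
  | consFormula _ Γ => Γ.width
  | consBox _ Γ => Γ.width + 1

/-- The content of the `i`-th boxed sequent at the root; `nil` if there is no such boxed sequent. -/
def child : PreSequent Atm → ℕ → PreSequent Atm
  | nil, _ => nil
  | consFormula _ Γ, i => Γ.child i
  | consBox Δ _, 0 => Δ
  | consBox _ Γ, i + 1 => Γ.child i

/-- Replacing the content of the `i`-th boxed sequent at the root, if there is one. -/
def setChild : PreSequent Atm → ℕ → PreSequent Atm → PreSequent Atm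
  | nil, _, _ => nil
  | consFormula A Γ, i, Θ => consFormula A (Γ.setChild i Θ)
  | consBox _ Γ, 0, Θ => consBox Θ Γ
  | consBox Δ Γ, i + 1, Θ => consBox Δ (Γ.setChild i Θ)

/-- The nested sequent at the position `w`, a list of indices of boxed sequents; `nil` if this
position does not exist. -/
def sub : PreSequent Atm → List ℕ → PreSequent Atm
  | Γ, [] => Γ
  | Γ, i :: w => (Γ.child i).sub w

/-- Replacing the nested sequent at the position `w`, if this position exists. -/
def setSub : PreSequent Atm → List ℕ → PreSequent Atm → PreSequent Atm
  | _, [], Θ => Θ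
  | Γ, i :: w, Θ => Γ.setChild i ((Γ.child i).setSub w Θ)

/-- The formulas at the position `w`. -/
def label (Γ : PreSequent Atm) (w : List ℕ) : Set (Formula Atm) := (Γ.sub w).formulas

theorem sub_nil (w : List ℕ) : (nil : PreSequent Atm).sub w = nil := by
  induction w with
  | nil => rfl
  | cons _ _ ih => exact ih

theorem sub_append (Γ : PreSequent Atm) (w v : List ℕ) : Γ.sub (w ++ v) = (Γ.sub w).sub v := by
  induction w generalizing Γ with
  | nil => rfl
  | cons i _ ih => exact ih _

theorem sub_ne_nil_of_append {Γ : PreSequent Atm} {w v : List ℕ} (h : Γ.sub (w ++ v) ≠ nil) :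
    Γ.sub w ≠ nil := by
  intro hw
  rw [sub_append, hw, sub_nil] at h
  exact h rfl

theorem sub_ne_nil_of_mem_label {Γ : PreSequent Atm} {w : List ℕ} {A : Formula Atm}
    (h : A ∈ Γ.label w) : Γ.sub w ≠ nil := by
  intro hw
  rw [label, hw] at h
  exact h

theorem formulas_append (Γ Δ : PreSequent Atm) :
    (Γ.append Δ).formulas = Γ.formulas ∪ Δ.formulas := by
  induction Γ <;> simp_all [append, formulas, Set.insert_union]

theorem child_append_of_lt {Γ : PreSequent Atm} (Δ : PreSequent Atm) {i : ℕ} (h : i < Γ.width) :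
    (Γ.append Δ).child i = Γ.child i := by
  induction Γ generalizing i with
  | nil => exact absurd h (Nat.not_lt_zero i)
  | consFormula A Γ ih => exact ih h
  | consBox Θ Γ _ ih =>
    cases i with
    | zero => rfl
    | succ i => exact ih (Nat.lt_of_succ_lt_succ h)

theorem child_append_width_add (Γ Δ : PreSequent Atm) (i : ℕ) :
    (Γ.append Δ).child (Γ.width + i) = Δ.child i := by
  induction Γ with
  | nil => rw [append, width, Nat.zero_add]
  | consFormula _ _ ih => exact ih
  | consBox Θ Γ _ ih => rw [append, width, Nat.succ_add, child, ih]

theorem child_of_width_le {Γ : PreSequent Atm} {i : ℕ} (h : Γ.width ≤ i) : Γ.child i = nil := by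
  induction Γ generalizing i with
  | nil => rfl
  | consFormula A Γ ih => exact ih h
  | consBox Θ Γ _ ih =>
    cases i with
    | zero => exact absurd h (Nat.not_succ_le_zero _)
    | succ i => exact ih (Nat.le_of_succ_le_succ h)

theorem label_subset_label_append (Γ Δ : PreSequent Atm) (w : List ℕ) :
    Γ.label w ⊆ (Γ.append Δ).label w := by
  cases w with
  | nil => exact Set.subset_union_left.trans (formulas_append Γ Δ).ge
  | cons i w =>
    rcases lt_or_ge i Γ.width with hi | hi
    · rw [label, label, sub, sub, child_append_of_lt Δ hi]
    · rw [label, sub, child_of_width_le hi, sub_nil]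
      exact Set.empty_subset _

theorem formulas_setChild (Γ : PreSequent Atm) (i : ℕ) (Θ : PreSequent Atm) :
    (Γ.setChild i Θ).formulas = Γ.formulas := by
  induction Γ generalizing i with
  | nil => rfl
  | consFormula A Γ ih => rw [setChild, formulas, formulas, ih]
  | consBox Δ Γ _ ih =>
    cases i with
    | zero => rfl
    | succ i => exact ih i

theorem child_setChild_self {Γ : PreSequent Atm} {i : ℕ} (h : Γ.child i ≠ nil)
    (Θ : PreSequent Atm) : (Γ.setChild i Θ).child i = Θ := by
  induction Γ generalizing i with
  | nil => exact absurd rfl h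
  | consFormula A Γ ih => exact ih h
  | consBox Δ Γ _ ih =>
    cases i with
    | zero => rfl
    | succ i => exact ih h

theorem child_setChild_of_ne (Γ Θ : PreSequent Atm) {i j : ℕ} (h : i ≠ j) :
    (Γ.setChild i Θ).child j = Γ.child j := by
  induction Γ generalizing i j with
  | nil => rfl
  | consFormula _ _ ih => exact ih h
  | consBox Δ Γ _ ih =>
    cases i <;> cases j
    · exact absurd rfl h
    · rfl
    · rfl
    · exact ih (by simpa using h)

theorem setChild_child (Γ : PreSequent Atm) (i : ℕ) : Γ.setChild i (Γ.child i) = Γ := by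
  induction Γ generalizing i with
  | nil => rfl
  | consFormula A Γ ih => rw [setChild, child, ih]
  | consBox Δ Γ _ ih =>
    cases i with
    | zero => rfl
    | succ i => rw [setChild, child, ih]

theorem setSub_sub (Γ : PreSequent Atm) (w : List ℕ) : Γ.setSub w (Γ.sub w) = Γ := by
  induction w generalizing Γ with
  | nil => rfl
  | cons i w ih => rw [setSub, sub, ih, setChild_child]

theorem setSub_append (Γ Θ : PreSequent Atm) (w v : List ℕ) :
    Γ.setSub (w ++ v) Θ = Γ.setSub w ((Γ.sub w).setSub v Θ) := by
  induction w generalizing Γ with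
  | nil => rfl
  | cons i w ih => rw [List.cons_append, setSub, ih, setSub, sub]

theorem child_ne_nil_of_sub_cons_ne_nil {Γ : PreSequent Atm} {i : ℕ} {w : List ℕ}
    (h : Γ.sub (i :: w) ≠ nil) : Γ.child i ≠ nil :=
  sub_ne_nil_of_append (w := [i]) h

theorem label_setSub_append {Γ : PreSequent Atm} {w : List ℕ} (h : Γ.sub w ≠ nil)
    (Θ : PreSequent Atm) (v : List ℕ) : (Γ.setSub w Θ).label (w ++ v) = Θ.label v := by
  induction w generalizing Γ with
  | nil => rfl
  | cons i w ih =>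
    rw [← ih h, List.cons_append, label, setSub, sub,
      child_setChild_self (child_ne_nil_of_sub_cons_ne_nil h), label]

theorem label_setSub_self {Γ : PreSequent Atm} {w : List ℕ} (h : Γ.sub w ≠ nil)
    (Θ : PreSequent Atm) : (Γ.setSub w Θ).label w = Θ.formulas :=
  (congrArg _ (List.append_nil w).symm).trans (label_setSub_append h Θ [])

theorem label_setSub_of_not_prefix {Γ : PreSequent Atm} {w : List ℕ} (h : Γ.sub w ≠ nil)
    (Θ : PreSequent Atm) {u : List ℕ} (hu : ¬ w <+: u) : (Γ.setSub w Θ).label u = Γ.label u := by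
  induction w generalizing Γ u with
  | nil => exact absurd List.nil_prefix hu
  | cons i w ih =>
    cases u with
    | nil => exact formulas_setChild Γ i _
    | cons j u =>
      by_cases hij : i = j
      · subst hij
        rw [label, setSub, sub, child_setChild_self (child_ne_nil_of_sub_cons_ne_nil h)]
        exact ih h fun hwu => hu (by simpa using hwu)
      · rw [label, setSub, sub, child_setChild_of_ne _ _ hij, label, sub]

theorem exists_toNSequent_setChild {Γ : PreSequent Atm} {i : ℕ} (h : Γ.child i ≠ nil) :
    ∃ Δ : NSequent Atm, ∀ Θ, (Γ.setChild i Θ).toNSequent = Δ + .boxed Θ.toNSequent := by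
  induction Γ generalizing i with
  | nil => exact absurd rfl h
  | consFormula A Γ ih =>
    obtain ⟨Δ, hΔ⟩ := ih h
    exact ⟨.ofFormula A + Δ, fun Θ => by rw [setChild, toNSequent_consFormula, hΔ, add_assoc]⟩
  | consBox Λ Γ _ ih =>
    cases i with
    | zero => exact ⟨Γ.toNSequent, fun Θ => by rw [setChild, toNSequent_consBox, add_comm]⟩
    | succ i =>
      obtain ⟨Δ, hΔ⟩ := ih h
      exact ⟨.boxed Λ.toNSequent + Δ, fun Θ => by
        rw [setChild, toNSequent_consBox, hΔ, add_assoc]⟩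

/-- `Γ'` arises from `Γ` by deleting an occurrence of the formula `A` at the root. The last field
allows for a simultaneous change inside a boxed sequent. -/
structure IsErase (A : Formula Atm) (Γ Γ' : PreSequent Atm) : Prop where
  formulas_eq : Γ.formulas = insert A Γ'.formulas
  child_eq : Γ'.child = Γ.child
  toNSequent_setChild : ∀ i Θ,
    (Γ.setChild i Θ).toNSequent = .ofFormula A + (Γ'.setChild i Θ).toNSequent

theorem IsErase.toNSequent_eq {A : Formula Atm} {Γ Γ' : PreSequent Atm} (h : IsErase A Γ Γ') :
    Γ.toNSequent = .ofFormula A + Γ'.toNSequent := by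
  have h₀ := h.toNSequent_setChild 0 (Γ.child 0)
  rwa [setChild_child, ← h.child_eq, setChild_child] at h₀

theorem exists_isErase {A : Formula Atm} {Γ : PreSequent Atm} (h : A ∈ Γ.formulas) :
    ∃ Γ', IsErase A Γ Γ' := by
  induction Γ with
  | nil => exact absurd h (Set.notMem_empty A)
  | consFormula B Γ ih =>
    rcases Set.mem_insert_iff.1 h with rfl | h
    · exact ⟨Γ, rfl, rfl, fun i Θ => rfl⟩
    · obtain ⟨Γ', hf, hc, hs⟩ := ih h
      refine ⟨consFormula B Γ', ?_, hc, fun i Θ => ?_⟩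
      · rw [formulas, formulas, hf, Set.insert_comm]
      · rw [setChild, toNSequent_consFormula, hs, add_left_comm]; rfl
  | consBox Δ Γ _ ih =>
    obtain ⟨Γ', hΓ'⟩ := ih h
    refine ⟨consBox Δ Γ', hΓ'.formulas_eq, ?_, fun i Θ => ?_⟩
    · funext i
      cases i with
      | zero => rfl
      | succ i => exact congrFun hΓ'.child_eq i
    · cases i with
      | zero => rw [setChild, toNSequent_consBox, hΓ'.toNSequent_eq, add_left_comm]; rfl
      | succ i => rw [setChild, toNSequent_consBox, hΓ'.toNSequent_setChild, add_left_comm]; rfl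

end PreSequent

namespace Context

/-- The number of boxes around the hole. -/
def depth : Context Atm → ℕ
  | hole _ => 0
  | nest _ C => C.depth + 1

/-- Adding a sequent next to the hole. -/
def addHole : Context Atm → NSequent Atm → Context Atm
  | hole Γ, Θ => hole (Γ + Θ)
  | nest Γ C, Θ => nest Γ (C.addHole Θ)

theorem fill_addHole (C : Context Atm) (Θ Λ : NSequent Atm) :
    (C.addHole Θ).fill Λ = C.fill (Θ + Λ) := by
  induction C with
  | hole Γ => exact add_assoc Γ Θ Λ
  | nest Γ C ih => rw [addHole, fill, ih, fill]

theorem depth_addHole (C : Context Atm) (Θ : NSequent Atm) : (C.addHole Θ).depth = C.depth := by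
  induction C with
  | hole Γ => rfl
  | nest Γ C ih => rw [addHole, depth, ih, depth]

theorem exists_fill_eq_add_chain (C : Context Atm) : ∃ (Γ : NSequent Atm) (Δs : _),
    Δs.length = C.depth ∧ ∀ Θ, C.fill Θ = Γ + NSequent.chain Δs Θ := by
  induction C with
  | hole Γ => exact ⟨Γ, [], rfl, fun Θ => rfl⟩
  | nest Γ C ih =>
    obtain ⟨Δ, Δs, hl, hΔ⟩ := ih
    exact ⟨Γ, Δ :: Δs, congrArg (· + 1) hl, fun Θ => by rw [fill, hΔ, NSequent.chain]⟩

end Context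

theorem PreSequent.exists_context {Γ : PreSequent Atm} {w : List ℕ} (h : Γ.sub w ≠ nil) :
    ∃ C : Context Atm, C.depth = w.length ∧
      ∀ Θ, (Γ.setSub w Θ).toNSequent = C.fill Θ.toNSequent := by
  induction w generalizing Γ with
  | nil => exact ⟨.hole 0, rfl, fun Θ => (zero_add _).symm⟩
  | cons i w ih =>
    obtain ⟨C, hC, hfill⟩ := ih (Γ := Γ.child i) h
    obtain ⟨Δ, hΔ⟩ := exists_toNSequent_setChild (child_ne_nil_of_sub_cons_ne_nil h)
    exact ⟨.nest Δ C, congrArg (· + 1) hC, fun Θ => by rw [setSub, hΔ, hfill, Context.fill]⟩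

end Positions

section Extension

open NSequent

namespace PreSequent

/-- `Γ.Realizes w A` means that `A` occurs at the position `w` of `Γ`, or that `Γ` contains what
the logical rules put in place of `A`: a conjunct, both disjuncts, or the body of a box in a boxed
sequent at `w`. Unlike occurrence, realization survives the application of the rules. -/
inductive Realizes (Γ : PreSequent Atm) : List ℕ → Formula Atm → Prop
  | mem {w : List ℕ} {A : Formula Atm} : A ∈ Γ.label w → Realizes Γ w A
  | and_left {w : List ℕ} {A B : Formula Atm} : Realizes Γ w A → Realizes Γ w (A.and B)
  | and_right {w : List ℕ} {A B : Formula Atm} : Realizes Γ w B → Realizes Γ w (A.and B)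
  | or {w : List ℕ} {A B : Formula Atm} :
      Realizes Γ w A → Realizes Γ w B → Realizes Γ w (A.or B)
  | box {w : List ℕ} {i : ℕ} {A : Formula Atm} : Realizes Γ (w ++ [i]) A → Realizes Γ w A.box

/-- Sequents are compared by the formulas that they realize. -/
instance : Preorder (PreSequent Atm) where
  le Γ Δ := ∀ w A, Γ.Realizes w A → Δ.Realizes w A
  le_refl _ _ _ := id
  le_trans _ _ _ h₁ h₂ w A := h₂ w A ∘ h₁ w A

theorem le_of_forall_mem_label {Γ Δ : PreSequent Atm}
    (h : ∀ w, ∀ A ∈ Γ.label w, Δ.Realizes w A) : Γ ≤ Δ := by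
  intro w A hA
  induction hA with
  | mem hA => exact h _ _ hA
  | and_left _ ih => exact .and_left ih
  | and_right _ ih => exact .and_right ih
  | or _ _ ih₁ ih₂ => exact .or ih₁ ih₂
  | box _ ih => exact .box ih

theorem Realizes.sub_ne_nil {Γ : PreSequent Atm} {w : List ℕ} {A : Formula Atm}
    (h : Γ.Realizes w A) : Γ.sub w ≠ nil := by
  induction h with
  | mem h => exact sub_ne_nil_of_mem_label h
  | box _ ih => exact sub_ne_nil_of_append ih
  | _ => assumption

/-- The logical rules replace an occurrence of their principal formula `F` by some sequent `Λ`. No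
realized formula is lost if `F` is still realized afterwards. -/
theorem exists_fill_ofFormula {Γ : PreSequent Atm} {w : List ℕ} {F : Formula Atm}
    (hF : F ∈ Γ.label w) :
    ∃ C : Context Atm, Γ.toNSequent = C.fill (ofFormula F) ∧
      ∀ Λ : PreSequent Atm, ∃ Γ' : PreSequent Atm, Γ'.toNSequent = C.fill Λ.toNSequent ∧
        Λ.formulas ⊆ Γ'.label w ∧ (∀ i, ∃ j, Λ.label [i] ⊆ Γ'.label (w ++ [j])) ∧
        (Γ'.Realizes w F → Γ ≤ Γ') := by
  have hw := sub_ne_nil_of_mem_label hF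
  obtain ⟨Θ, hΘ⟩ := exists_isErase hF
  obtain ⟨C, -, hC⟩ := exists_context hw
  refine ⟨C.addHole Θ.toNSequent, ?_, fun Λ => ⟨Γ.setSub w (Θ.append Λ), ?_, ?_, fun i => ?_, ?_⟩⟩
  · rw [Context.fill_addHole, add_comm, ← hΘ.toNSequent_eq, ← hC, setSub_sub]
  · rw [hC, toNSequent_append, Context.fill_addHole]
  · rw [label_setSub_self hw, formulas_append]
    exact Set.subset_union_right
  · refine ⟨Θ.width + i, ?_⟩
    rw [label_setSub_append hw]
    exact (congrArg formulas (child_append_width_add Θ Λ i)).ge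
  · refine fun hR => le_of_forall_mem_label fun u A hA => ?_
    by_cases hu : w <+: u
    · obtain ⟨v, rfl⟩ := hu
      rcases eq_or_ne (v, A) ([], F) with h | h
      · obtain ⟨rfl, rfl⟩ := Prod.mk.inj h
        rwa [List.append_nil]
      · refine .mem ((label_setSub_append hw _ v).ge (label_subset_label_append Θ Λ v ?_))
        rw [label, sub_append] at hA
        cases v with
        | nil => exact (hΘ.formulas_eq.le hA).resolve_left fun hAF => h (by rw [hAF])
        | cons i v => rwa [label, sub, hΘ.child_eq]
    · exact .mem ((label_setSub_of_not_prefix hw _ hu).ge hA)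

/-- In the propagation rules `F` is the principal formula `◇A` at `w`, and `Λ`, added at the proper
descendant `w ++ v` of `w`, is empty in the conclusion and `A` or `◇A` in the premise. -/
theorem exists_fill_ofFormula_add_chain {Γ : PreSequent Atm} {w v : List ℕ} {F : Formula Atm}
    (hF : F ∈ Γ.label w) (hv : v ≠ []) (hwv : Γ.sub (w ++ v) ≠ nil) :
    ∃ (C : Context Atm) (Δs : List (NSequent Atm)), Δs.length = v.length ∧
      ∀ (Θ : PreSequent Atm) (Λ : NSequent Atm), Θ.toNSequent = Λ + (Γ.sub (w ++ v)).toNSequent →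
        (Γ.setSub (w ++ v) Θ).toNSequent = C.fill (ofFormula F + chain Δs Λ) := by
  obtain ⟨i, v, rfl⟩ := List.exists_cons_of_ne_nil hv
  obtain ⟨Γ', hΓ'⟩ := exists_isErase hF
  have hsub : Γ'.sub (i :: v) = Γ.sub (w ++ i :: v) := by
    rw [sub_append, sub, sub, hΓ'.child_eq]
  obtain ⟨C, -, hC⟩ := exists_context (sub_ne_nil_of_mem_label hF)
  obtain ⟨D, hDv, hD⟩ := exists_context (hsub.trans_ne hwv)
  obtain ⟨Δ, Δs, hl, hΔs⟩ := (D.addHole (Γ.sub (w ++ i :: v)).toNSequent).exists_fill_eq_add_chain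
  refine ⟨C.addHole Δ, Δs, by rw [hl, Context.depth_addHole, hDv], fun Θ Λ hΘ => ?_⟩
  have hset : ((Γ.sub w).setSub (i :: v) Θ).toNSequent = ofFormula F + D.fill Θ.toNSequent := by
    rw [setSub, hΓ'.toNSequent_setChild, ← hD, setSub, hΓ'.child_eq]
  rw [setSub_append, hC, hset, hΘ, add_comm Λ, ← D.fill_addHole, hΔs, add_left_comm,
    Context.fill_addHole]

theorem le_setSub_consFormula {Γ : PreSequent Atm} {w : List ℕ} (hw : Γ.sub w ≠ nil)
    (F : Formula Atm) : Γ ≤ Γ.setSub w (consFormula F (Γ.sub w)) := by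
  refine le_of_forall_mem_label fun u A hA => .mem ?_
  by_cases hu : w <+: u
  · obtain ⟨v, rfl⟩ := hu
    rw [label_setSub_append hw]
    rw [label, sub_append] at hA
    cases v with
    | nil => exact Set.mem_insert_of_mem F hA
    | cons i v => exact hA
  · rwa [label_setSub_of_not_prefix hw _ hu]

end PreSequent

open PreSequent

variable {S : System Atm} {Γ : PreSequent Atm} {w : List ℕ} {A B : Formula Atm}

theorem exists_premise_not_provable {Ps : List (NSequent Atm)} {Θ : NSequent Atm}
    (hr : (Ps, Θ) ∈ S) (h : ¬ Provable S Θ) : ∃ P ∈ Ps, ¬ Provable S P := by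
  by_contra! hP
  exact h (.infer hr hP)

theorem not_realizes_atom_and_natom (hS : nK Atm ⊆ S) (h : ¬ Provable S Γ.toNSequent) (p : Atm)
    (hp : Γ.Realizes w (.atom p)) : ¬ Γ.Realizes w (.natom p) := by
  rintro ⟨hn⟩
  obtain ⟨hp⟩ := hp
  obtain ⟨C, -, hC⟩ := exists_context (sub_ne_nil_of_mem_label hp)
  obtain ⟨Θ, hΘ⟩ := exists_isErase hp
  rw [label, hΘ.formulas_eq] at hn
  obtain ⟨Λ, hΛ⟩ := exists_isErase (hn.resolve_left nofun)
  have hΓ : Γ.toNSequent =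
      (C.addHole Λ.toNSequent).fill (ofFormula (.atom p) + ofFormula (.natom p)) := by
    rw [Context.fill_addHole, add_comm, add_assoc, ← hΛ.toNSequent_eq, ← hΘ.toNSequent_eq, ← hC,
      setSub_sub]
  exact h (hΓ ▸ .infer (hS (NKRule.id _ p)) (by simp))

theorem exists_le_realizes_and (hS : nK Atm ⊆ S) (h : ¬ Provable S Γ.toNSequent)
    (hAB : Γ.Realizes w (A.and B)) :
    ∃ Γ' ≥ Γ, ¬ Provable S Γ'.toNSequent ∧ (Γ'.Realizes w A ∨ Γ'.Realizes w B) := by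
  cases hAB with
  | and_left hA => exact ⟨Γ, le_rfl, h, .inl hA⟩
  | and_right hB => exact ⟨Γ, le_rfl, h, .inr hB⟩
  | mem hAB =>
    obtain ⟨C, hC, hrep⟩ := exists_fill_ofFormula hAB
    rw [hC] at h
    obtain ⟨P, hP, hn⟩ := exists_premise_not_provable (hS (NKRule.and C A B)) h
    rcases List.mem_pair.1 hP with rfl | rfl
    · obtain ⟨Γ', hΓ', hmem, -, hle⟩ := hrep (consFormula A nil)
      have hA : Γ'.Realizes w A := .mem (hmem (Set.mem_insert A _))
      exact ⟨Γ', hle hA.and_left, hΓ' ▸ hn, .inl hA⟩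
    · obtain ⟨Γ', hΓ', hmem, -, hle⟩ := hrep (consFormula B nil)
      have hB : Γ'.Realizes w B := .mem (hmem (Set.mem_insert B _))
      exact ⟨Γ', hle hB.and_right, hΓ' ▸ hn, .inr hB⟩

theorem exists_le_realizes_or (hS : nK Atm ⊆ S) (h : ¬ Provable S Γ.toNSequent)
    (hAB : Γ.Realizes w (A.or B)) :
    ∃ Γ' ≥ Γ, ¬ Provable S Γ'.toNSequent ∧ Γ'.Realizes w A ∧ Γ'.Realizes w B := by
  cases hAB with
  | or hA hB => exact ⟨Γ, le_rfl, h, hA, hB⟩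
  | mem hAB =>
    obtain ⟨C, hC, hrep⟩ := exists_fill_ofFormula hAB
    rw [hC] at h
    obtain ⟨P, hP, hn⟩ := exists_premise_not_provable (hS (NKRule.or C A B)) h
    obtain rfl := List.mem_singleton.1 hP
    obtain ⟨Γ', hΓ', hmem, -, hle⟩ := hrep (consFormula A (consFormula B nil))
    have hA : Γ'.Realizes w A := .mem (hmem (Set.mem_insert A _))
    have hB : Γ'.Realizes w B := .mem (hmem (Set.mem_insert_of_mem A (Set.mem_insert B _)))
    exact ⟨Γ', hle (hA.or hB), hΓ' ▸ hn, hA, hB⟩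

theorem exists_le_realizes_box (hS : nK Atm ⊆ S) (h : ¬ Provable S Γ.toNSequent)
    (hA : Γ.Realizes w A.box) :
    ∃ Γ' ≥ Γ, ¬ Provable S Γ'.toNSequent ∧ ∃ i, Γ'.Realizes (w ++ [i]) A := by
  cases hA with
  | box hA => exact ⟨Γ, le_rfl, h, _, hA⟩
  | mem hA =>
    obtain ⟨C, hC, hrep⟩ := exists_fill_ofFormula hA
    rw [hC] at h
    obtain ⟨P, hP, hn⟩ := exists_premise_not_provable (hS (NKRule.box C A)) h
    obtain rfl := List.mem_singleton.1 hP
    obtain ⟨Γ', hΓ', -, hchild, hle⟩ := hrep (consBox (consFormula A nil) nil)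
    obtain ⟨i, hi⟩ := hchild 0
    have hA : Γ'.Realizes (w ++ [i]) A := .mem (hi (Set.mem_insert A _))
    exact ⟨Γ', hle hA.box, hΓ' ▸ hn, i, hA⟩

theorem exists_le_realizes_of_dia {v : List ℕ} (hv : v ≠ [])
    (hS : ∀ C Δs, Δs.length = v.length →
      Provable S (Context.fill C (ofFormula A.dia + chain Δs (ofFormula B))) →
        Provable S (C.fill (ofFormula A.dia + chain Δs 0)))
    (h : ¬ Provable S Γ.toNSequent) (hA : Γ.Realizes w A.dia) (hwv : Γ.sub (w ++ v) ≠ nil) :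
    ∃ Γ' ≥ Γ, ¬ Provable S Γ'.toNSequent ∧ Γ'.Realizes (w ++ v) B := by
  obtain ⟨hA⟩ := hA
  obtain ⟨C, Δs, hl, hset⟩ := exists_fill_ofFormula_add_chain hA hv hwv
  refine ⟨_, le_setSub_consFormula hwv B, fun hB => h ?_, .mem ?_⟩
  · rw [← setSub_sub Γ (w ++ v), hset _ 0 (zero_add _).symm]
    rw [hset _ _ (toNSequent_consFormula B _)] at hB
    exact hS C Δs hl hB
  · rw [label_setSub_self hwv]
    exact Set.mem_insert B _

theorem provable_fill_dia_add_chain_of_nK (hS : nK Atm ⊆ S) (C : Context Atm)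
    {Δs : List (NSequent Atm)} (hl : Δs.length = 1)
    (h : Provable S (C.fill (ofFormula A.dia + chain Δs (ofFormula A)))) :
    Provable S (C.fill (ofFormula A.dia + chain Δs 0)) := by
  obtain ⟨Δ, rfl⟩ := List.length_eq_one_iff.1 hl
  simp only [chain, add_zero] at h ⊢
  exact .infer (hS (NKRule.dia C A Δ)) (List.forall_mem_singleton.2 (add_comm Δ _ ▸ h))

theorem provable_fill_dia_add_chain_of_dia4 {n : ℕ} (hS : dia4 Atm n ⊆ S) (C : Context Atm)
    {Δs : List (NSequent Atm)} (hl : Δs.length + 1 = n)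
    (h : Provable S (C.fill (ofFormula A.dia + chain Δs (ofFormula A.dia)))) :
    Provable S (C.fill (ofFormula A.dia + chain Δs 0)) :=
  .infer (hS ⟨C, A, Δs, hl, rfl⟩) (List.forall_mem_singleton.2 h)

end Extension

section Saturation

/-- The set of subformulas of a formula. -/
def Formula.subformulas : Formula Atm → Set (Formula Atm)
  | atom p => {atom p}
  | natom p => {natom p}
  | and A B => insert (and A B) (A.subformulas ∪ B.subformulas)
  | or A B => insert (or A B) (A.subformulas ∪ B.subformulas)
  | box A => insert (box A) A.subformulas
  | dia A => insert (dia A) A.subformulas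

@[simp]
theorem Formula.mem_subformulas_self (A : Formula Atm) : A ∈ A.subformulas := by
  cases A <;> simp [subformulas]

theorem Formula.countable_subformulas (A : Formula Atm) : A.subformulas.Countable := by
  induction A <;> simp_all [subformulas]

theorem Formula.subformulas_subset {A B : Formula Atm} (h : B ∈ A.subformulas) :
    B.subformulas ⊆ A.subformulas := by
  induction A with
  | atom p | natom p => rw [Set.mem_singleton_iff.1 h]
  | and A C ihA ihC | or A C ihA ihC =>
    rcases h with rfl | h | h
    · rfl
    · exact (ihA h).trans (Set.subset_union_left.trans (Set.subset_insert _ _))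
    · exact (ihC h).trans (Set.subset_union_right.trans (Set.subset_insert _ _))
  | box A ih | dia A ih =>
    rcases h with rfl | h
    · rfl
    · exact (ih h).trans (Set.subset_insert _ _)

theorem exists_ideal_answering {P ι : Type*} [Preorder P] [Countable ι] {a b : ι → P → Prop}
    (ha : ∀ i, Monotone (a i)) (hab : ∀ i s, a i s → ∃ s' ≥ s, b i s') (p : P) :
    ∃ I : Order.Ideal P, p ∈ I ∧ ∀ i, ∀ s ∈ I, a i s → ∃ s' ∈ I, b i s' := by
  have := Encodable.ofCountable ι
  let D : ι → Order.Cofinal P := fun i =>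
    { carrier := {s | b i s ∨ ∀ s' ≥ s, ¬ a i s'}
      isCofinal := by
        intro s
        by_cases! h : ∃ s' ≥ s, a i s'
        · obtain ⟨s', hs, h⟩ := h
          obtain ⟨s'', hs', h'⟩ := hab i s' h
          exact ⟨s'', .inl h', hs.trans hs'⟩
        · exact ⟨s, .inr h, le_rfl⟩ }
  refine ⟨Order.idealOfCofinals p D, Order.mem_idealOfCofinals p D, fun i s hs h => ?_⟩
  obtain ⟨s', hb | hn, hs'⟩ := Order.cofinal_meets_idealOfCofinals p D i
  · exact ⟨s', hs', hb⟩
  · obtain ⟨t, -, hst, hst'⟩ := (Order.idealOfCofinals p D).directed s hs s' hs'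
    exact absurd (ha i hst h) (hn t hst')

/-- What the rules ask of a sequent that realizes `F` at `w` and has a position `w ++ v`: for
`F = ◇A` the propagation rules may put `A` or `◇A` at `w ++ v`. -/
def PreSequent.Answers (X : Set ℕ) (Γ : PreSequent Atm) (w v : List ℕ) : Formula Atm → Prop
  | .and A B => Γ.Realizes w A ∨ Γ.Realizes w B
  | .or A B => Γ.Realizes w A ∧ Γ.Realizes w B
  | .box A => ∃ i, Γ.Realizes (w ++ [i]) A
  | .dia A => (v.length = 1 → Γ.Realizes (w ++ v) A) ∧
      (v.length + 1 ∈ X → Γ.Realizes (w ++ v) A.dia)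
  | _ => True

/-- Unprovable ordered sequents. -/
abbrev Unprovable (S : System Atm) : Type _ := {Γ : PreSequent Atm // ¬ Provable S Γ.toNSequent}

variable {X : Set ℕ}

theorem dia4_subset_dia4Set {n : ℕ} (hn : n ∈ X) : dia4 Atm n ⊆ dia4Set Atm X :=
  Set.subset_biUnion_of_mem (u := dia4 Atm) hn

theorem exists_le_answers_dia {Γ : PreSequent Atm} {w v u : List ℕ} {A B : Formula Atm}
    (h : ¬ Provable (nK Atm ∪ dia4Set Atm X) Γ.toNSequent) (hA : Γ.Realizes w A.dia)
    (hB : Γ.Realizes (w ++ v ++ u) B) :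
    ∃ Γ' ≥ Γ, ¬ Provable (nK Atm ∪ dia4Set Atm X) Γ'.toNSequent ∧ Γ'.Answers X w v A.dia := by
  obtain ⟨Γ₁, h₁, hn₁, hA₁⟩ : ∃ Γ₁ ≥ Γ, ¬ Provable (nK Atm ∪ dia4Set Atm X) Γ₁.toNSequent ∧
      (v.length = 1 → Γ₁.Realizes (w ++ v) A) := by
    by_cases hv : v.length = 1
    · obtain ⟨Γ₁, h₁, hn₁, hA₁⟩ := exists_le_realizes_of_dia (by rintro rfl; cases hv)
        (fun C Δs hl => provable_fill_dia_add_chain_of_nK Set.subset_union_left C (hl.trans hv))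
        h hA (PreSequent.sub_ne_nil_of_append hB.sub_ne_nil)
      exact ⟨Γ₁, h₁, hn₁, fun _ => hA₁⟩
    · exact ⟨Γ, le_rfl, h, fun hv' => absurd hv' hv⟩
  by_cases hv : v ≠ [] ∧ v.length + 1 ∈ X
  · obtain ⟨Γ₂, h₂, hn₂, hA₂⟩ := exists_le_realizes_of_dia hv.1
      (fun C Δs hl => provable_fill_dia_add_chain_of_dia4
        ((dia4_subset_dia4Set hv.2).trans Set.subset_union_right) C (congrArg (· + 1) hl))
      hn₁ (h₁ _ _ hA) (PreSequent.sub_ne_nil_of_append (h₁ _ _ hB).sub_ne_nil)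
    exact ⟨Γ₂, h₁.trans h₂, hn₂, fun hl => h₂ _ _ (hA₁ hl), fun _ => hA₂⟩
  · refine ⟨Γ₁, h₁, hn₁, hA₁, fun hX => ?_⟩
    obtain rfl : v = [] := by simpa [hX] using hv
    rw [List.append_nil]
    exact h₁ _ _ hA

theorem Unprovable.exists_le_answers (Γ : Unprovable (nK Atm ∪ dia4Set Atm X)) {w v u : List ℕ}
    {A B : Formula Atm} (hA : Γ.1.Realizes w A) (hB : Γ.1.Realizes (w ++ v ++ u) B) :
    ∃ Γ' ≥ Γ, Γ'.1.Answers X w v A := by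
  have hnK : nK Atm ⊆ nK Atm ∪ dia4Set Atm X := Set.subset_union_left
  obtain ⟨Γ', hle, hn, hA'⟩ : ∃ Γ' ≥ Γ.1, ¬ Provable (nK Atm ∪ dia4Set Atm X) Γ'.toNSequent ∧
      Γ'.Answers X w v A := by
    cases A with
    | atom p | natom p => exact ⟨Γ.1, le_rfl, Γ.2, trivial⟩
    | and A B => exact exists_le_realizes_and hnK Γ.2 hA
    | or A B => exact exists_le_realizes_or hnK Γ.2 hA
    | box A => exact exists_le_realizes_box hnK Γ.2 hA
    | dia A => exact exists_le_answers_dia Γ.2 hA hB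
  exact ⟨⟨Γ', hn⟩, hle, hA'⟩

/-- An ideal of unprovable sequents is generic for a set `Φ` of formulas if every demand that a rule
makes on one of its members, for a formula in `Φ`, is met by one of its members. -/
def IsGeneric (Φ : Set (Formula Atm)) (I : Order.Ideal (Unprovable (nK Atm ∪ dia4Set Atm X))) :
    Prop :=
  ∀ ⦃Γ⦄, Γ ∈ I → ∀ ⦃w v u A B⦄, A ∈ Φ → Γ.1.Realizes w A → Γ.1.Realizes (w ++ v ++ u) B →
    ∃ Γ' ∈ I, Γ'.1.Answers X w v A

theorem Unprovable.exists_isGeneric (Γ₀ : Unprovable (nK Atm ∪ dia4Set Atm X))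
    {Φ : Set (Formula Atm)} (hΦ : Φ.Countable) : ∃ I, Γ₀ ∈ I ∧ IsGeneric Φ I := by
  have := hΦ.to_subtype
  obtain ⟨I, h₀, hI⟩ := exists_ideal_answering (ι := List ℕ × List ℕ × Φ)
    (a := fun i Γ => Γ.1.Realizes i.1 i.2.2 ∧ ∃ u B, Γ.1.Realizes (i.1 ++ i.2.1 ++ u) B)
    (b := fun i Γ => Γ.1.Answers X i.1 i.2.1 i.2.2)
    (fun i Γ Γ' hle ⟨hA, u, B, hB⟩ => ⟨hle _ _ hA, u, B, hle _ _ hB⟩)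
    (fun i Γ ⟨hA, u, B, hB⟩ => Γ.exists_le_answers hA hB) Γ₀
  exact ⟨I, h₀, fun Γ hΓ w v u A B hA hRA hRB => hI (w, v, ⟨A, hA⟩) Γ hΓ ⟨hRA, u, B, hRB⟩⟩

/-- The positions of a labelling of the tree `List ℕ`: the prefixes of the points with a nonempty
label. -/
def positions (T : List ℕ → Set (Formula Atm)) : Set (List ℕ) := {w | ∃ v, (T (w ++ v)).Nonempty}

theorem mem_positions_of_mem {T : List ℕ → Set (Formula Atm)} {w : List ℕ} {A : Formula Atm}
    (h : A ∈ T w) : w ∈ positions T :=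
  ⟨[], A, by rwa [List.append_nil]⟩

theorem mem_positions_of_append {T : List ℕ → Set (Formula Atm)} {w v : List ℕ}
    (h : w ++ v ∈ positions T) : w ∈ positions T := by
  obtain ⟨u, hu⟩ := h
  exact ⟨v ++ u, by rwa [← List.append_assoc]⟩

/-- Hintikka labellings of the tree `List ℕ` for `nK + ◇₄X`: the formulas in the label of a point
are those to be falsified there, and the labelling is saturated under the rules. -/
structure IsHintikka (X : Set ℕ) (T : List ℕ → Set (Formula Atm)) : Prop where
  atom {w : List ℕ} {p : Atm} : .atom p ∈ T w → .natom p ∉ T w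
  and {w : List ℕ} {A B : Formula Atm} : A.and B ∈ T w → A ∈ T w ∨ B ∈ T w
  or {w : List ℕ} {A B : Formula Atm} : A.or B ∈ T w → A ∈ T w ∧ B ∈ T w
  box {w : List ℕ} {A : Formula Atm} : A.box ∈ T w → ∃ i, A ∈ T (w ++ [i])
  dia {w : List ℕ} {i : ℕ} {A : Formula Atm} :
    A.dia ∈ T w → w ++ [i] ∈ positions T → A ∈ T (w ++ [i])
  dia_four {w v : List ℕ} {A : Formula Atm} :
    v.length + 1 ∈ X → A.dia ∈ T w → w ++ v ∈ positions T → A.dia ∈ T (w ++ v)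

/-- The formulas of `Φ` that some member of the ideal `I` realizes at the position `w`. -/
def limitLabel {S : System Atm} (Φ : Set (Formula Atm)) (I : Order.Ideal (Unprovable S))
    (w : List ℕ) : Set (Formula Atm) :=
  {A | A ∈ Φ ∧ ∃ Γ ∈ I, Γ.1.Realizes w A}

section IsGeneric

variable {Φ : Set (Formula Atm)} {I : Order.Ideal (Unprovable (nK Atm ∪ dia4Set Atm X))}

theorem IsGeneric.exists_answers (hI : IsGeneric Φ I) {w v : List ℕ} {A : Formula Atm}
    (hA : A ∈ limitLabel Φ I w) (hv : w ++ v ∈ positions (limitLabel Φ I)) :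
    ∃ Γ ∈ I, Γ.1.Answers X w v A := by
  obtain ⟨hAΦ, Γ, hΓ, hA⟩ := hA
  obtain ⟨u, B, -, Γ', hΓ', hB⟩ := hv
  obtain ⟨Δ, hΔ, hle, hle'⟩ := I.directed Γ hΓ Γ' hΓ'
  exact hI hΔ hAΦ (hle _ _ hA) (hle' _ _ hB)

theorem IsGeneric.exists_answers_nil (hI : IsGeneric Φ I) {w : List ℕ} {A : Formula Atm}
    (hA : A ∈ limitLabel Φ I w) : ∃ Γ ∈ I, Γ.1.Answers X w [] A :=
  hI.exists_answers hA (by rw [List.append_nil]; exact mem_positions_of_mem hA)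

theorem IsGeneric.isHintikka (hI : IsGeneric Φ I) (hΦ : ∀ A ∈ Φ, A.subformulas ⊆ Φ) :
    IsHintikka X (limitLabel Φ I) where
  atom := by
    rintro w p ⟨-, Γ, hΓ, hp⟩ ⟨-, Γ', hΓ', hn⟩
    obtain ⟨Δ, -, hle, hle'⟩ := I.directed Γ hΓ Γ' hΓ'
    exact not_realizes_atom_and_natom Set.subset_union_left Δ.2 p (hle _ _ hp) (hle' _ _ hn)
  and h := by
    obtain ⟨Γ, hΓ, hA | hB⟩ := hI.exists_answers_nil h
    · exact .inl ⟨hΦ _ h.1 (by simp [Formula.subformulas]), Γ, hΓ, hA⟩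
    · exact .inr ⟨hΦ _ h.1 (by simp [Formula.subformulas]), Γ, hΓ, hB⟩
  or h := by
    obtain ⟨Γ, hΓ, hA, hB⟩ := hI.exists_answers_nil h
    exact ⟨⟨hΦ _ h.1 (by simp [Formula.subformulas]), Γ, hΓ, hA⟩,
      hΦ _ h.1 (by simp [Formula.subformulas]), Γ, hΓ, hB⟩
  box h := by
    obtain ⟨Γ, hΓ, i, hA⟩ := hI.exists_answers_nil h
    exact ⟨i, hΦ _ h.1 (by simp [Formula.subformulas]), Γ, hΓ, hA⟩
  dia h hi := by
    obtain ⟨Γ, hΓ, hA, -⟩ := hI.exists_answers h hi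
    exact ⟨hΦ _ h.1 (by simp [Formula.subformulas]), Γ, hΓ, hA rfl⟩
  dia_four hX h hv := by
    obtain ⟨Γ, hΓ, -, hA⟩ := hI.exists_answers h hv
    exact ⟨h.1, Γ, hΓ, hA hX⟩

end IsGeneric

theorem exists_isHintikka_of_not_provable {A : Formula Atm}
    (h : ¬ Provable (nK Atm ∪ dia4Set Atm X) (.ofFormula A)) :
    ∃ T : List ℕ → Set (Formula Atm), IsHintikka X T ∧ A ∈ T [] := by
  let Γ₀ : Unprovable (nK Atm ∪ dia4Set Atm X) := ⟨.consFormula A .nil, h⟩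
  obtain ⟨I, hΓ₀, hI⟩ := Γ₀.exists_isGeneric A.countable_subformulas
  exact ⟨limitLabel A.subformulas I, hI.isHintikka fun B => Formula.subformulas_subset,
    A.mem_subformulas_self, Γ₀, hΓ₀, .mem (Set.mem_insert A _)⟩

end Saturation

section Completeness

variable {X : Set ℕ} {T : List ℕ → Set (Formula Atm)}

/-- The submonoid of `ℕ` generated by the numbers `n - 1` with `n ∈ X`. The axioms `4ⁿ` for `n ∈ X`
yield `◇ˢ⁺¹ A ⊃ ◇ A` for every `s` in it. -/
def excess (X : Set ℕ) : AddSubmonoid ℕ := AddSubmonoid.closure {m | m + 1 ∈ X}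

/-- The accessibility relation of the countermodel: a point sees the positions that lie `s + 1`
levels deeper, for `s` in `excess X`. -/
def TreeRel (X : Set ℕ) (T : List ℕ → Set (Formula Atm)) (w u : List ℕ) : Prop :=
  u ∈ positions T ∧ ∃ v, u = w ++ v ∧ ∃ s ∈ excess X, v.length = s + 1

theorem exists_append_mem_of_mem_iterate_diamond (n : ℕ) {S : Set (List ℕ)} {w : List ℕ}
    (h : w ∈ (diamond (kripkeBox (TreeRel X T)))^[n + 1] S) :
    ∃ v, w ++ v ∈ S ∩ positions T ∧ ∃ s ∈ excess X, v.length = s + (n + 1) := by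
  induction n generalizing w with
  | zero =>
    obtain ⟨_, ⟨hT, v, rfl, s, hs, hl⟩, hS⟩ := (mem_diamond_kripkeBox _).1 h
    exact ⟨v, ⟨hS, hT⟩, s, hs, hl⟩
  | succ n ih =>
    rw [Function.iterate_succ_apply'] at h
    obtain ⟨_, ⟨-, v, rfl, s, hs, hl⟩, h⟩ := (mem_diamond_kripkeBox _).1 h
    obtain ⟨u, hu, t, ht, hl'⟩ := ih h
    refine ⟨v ++ u, by rwa [← List.append_assoc], s + t, add_mem hs ht, ?_⟩
    rw [List.length_append, hl, hl']
    ring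

theorem isQuasiTransitive_treeRel (hX : 0 ∉ X) :
    IsQuasiTransitive (kripkeBox (TreeRel X T)) X := by
  intro n hn S w hw
  obtain ⟨m, rfl⟩ := Nat.exists_eq_succ_of_ne_zero (ne_of_mem_of_not_mem hn hX)
  obtain ⟨v, ⟨hS, hT⟩, s, hs, hl⟩ := exists_append_mem_of_mem_iterate_diamond m hw
  have hsm : s + m ∈ excess X := add_mem hs (AddSubmonoid.subset_closure hn)
  exact (mem_diamond_kripkeBox _).2 ⟨w ++ v, ⟨hT, v, rfl, s + m, hsm, hl⟩, hS⟩

theorem IsHintikka.dia_mem_of_mem_excess (hT : IsHintikka X T) {A : Formula Atm} {s : ℕ}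
    (hs : s ∈ excess X) {w v : List ℕ} (hv : v.length = s) (hA : A.dia ∈ T w)
    (hwv : w ++ v ∈ positions T) : A.dia ∈ T (w ++ v) := by
  induction hs using AddSubmonoid.closure_induction generalizing w v with
  | mem s hs => exact hT.dia_four (hv ▸ hs) hA hwv
  | zero => rwa [List.length_eq_zero_iff.1 hv, List.append_nil]
  | add s t _ _ ihs iht =>
    rw [← List.take_append_drop s v, ← List.append_assoc] at hwv ⊢
    exact iht (by simp [hv]) (ihs (by simp [hv]) hA (mem_positions_of_append hwv)) hwv

theorem IsHintikka.mem_of_treeRel (hT : IsHintikka X T) {A : Formula Atm} {w u : List ℕ}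
    (hA : A.dia ∈ T w) (hu : TreeRel X T w u) : A ∈ T u := by
  obtain ⟨hu, v, rfl, s, hs, hl⟩ := hu
  obtain ⟨v, i, rfl⟩ :=
    (List.eq_nil_or_concat' v).resolve_left (List.ne_nil_of_length_eq_add_one hl)
  rw [← List.append_assoc] at hu ⊢
  exact hT.dia (hT.dia_mem_of_mem_excess hs (by simpa using hl) hA (mem_positions_of_append hu)) hu

theorem IsHintikka.notMem_eval (hT : IsHintikka X T) {A : Formula Atm} {w : List ℕ}
    (hA : A ∈ T w) : w ∉ A.eval (kripkeBox (TreeRel X T)) fun p => {w | .atom p ∉ T w} := by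
  induction A generalizing w with
  | atom p => exact fun h => h hA
  | natom p => exact fun h => h fun hp => hT.atom hp hA
  | and A B ihA ihB => exact fun h => (hT.and hA).elim (ihA · h.1) (ihB · h.2)
  | or A B ihA ihB => exact fun h => h.elim (ihA (hT.or hA).1) (ihB (hT.or hA).2)
  | box A ih =>
    obtain ⟨i, hi⟩ := hT.box hA
    exact fun h => ih hi (h _ ⟨mem_positions_of_mem hi, [i], rfl, 0, zero_mem _, rfl⟩)
  | dia A ih =>
    intro h
    obtain ⟨u, hu, hAu⟩ := (mem_diamond_kripkeBox _).1 h
    exact ih (hT.mem_of_treeRel hA hu) hAu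

theorem KTheorem.provable (hX : 0 ∉ X) {A : Formula Atm}
    (h : KTheorem (quasiTransAxioms Atm X) A) :
    Provable (nK Atm ∪ dia4Set Atm X) (.ofFormula A) := by
  by_contra hA
  obtain ⟨T, hT, hAT⟩ := exists_isHintikka_of_not_provable hA
  refine hT.notMem_eval hAT ?_
  rw [h.eval_eq_top _ _ (isQuasiTransitive_treeRel hX)]
  trivial

end Completeness

end QuasiTrans

theorem theorem3_general {Atm : Type*} (X : Set ℕ) (hX : 0 ∉ X) (A : QuasiTrans.Formula Atm) :
    QuasiTrans.KTheorem (QuasiTrans.quasiTransAxioms Atm X) A ↔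
      QuasiTrans.Provable (QuasiTrans.nK Atm ∪ QuasiTrans.dia4Set Atm X)
        (QuasiTrans.NSequent.ofFormula A) :=
  ⟨QuasiTrans.KTheorem.provable hX, QuasiTrans.Provable.kTheorem⟩

theorem theorem3 {Atm : Type*} [Countable Atm] (X : Set ℕ) (hX : X ⊆ {n : ℕ | 1 < n})
    (A : QuasiTrans.Formula Atm) :
    QuasiTrans.KTheorem (QuasiTrans.quasiTransAxioms Atm X) A ↔
      QuasiTrans.Provable (QuasiTrans.nK Atm ∪ QuasiTrans.dia4Set Atm X)
        (QuasiTrans.NSequent.ofFormula A) :=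
  theorem3_general X (fun h => absurd (hX h) (by simp)) A
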